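/- Let $p$ be a prime number. For a commutative ring $R$ of characteristic $p$ and $e\in\mathbb{N}=\{0,1,2,\dots\}$, let $R^{p^e}=\{r^{p^e}: r\in R\}$ be the subring of $p^e$-th powers and let $D_R^{(e)}=\operatorname{End}_{R^{p^e}}(R)$ be the ring of differential operators of level $e$ on $R$. For an ideal $I\subseteq R$ let $D_R^{(e)}\cdot I$ be the $D_R^{(e)}$-submodule of $R$ generated by $I$, and set $$\mathcal{B}^\bullet_I(p^e)=\{n\in\mathbb{N}: D_R^{(e)}\cdot I^n\supsetneq D_R^{(e)}\cdot I^{n+1}\}.$$ A $p$-adic integer $x\in\mathbb{Z}_p$ is a Bernstein–Sato root of $I$ if there is a sequence $(\nu_e)_{e\in\mathbb{N}}$ with $\nu_e\in\mathcal{B}^\bullet_I(p^e)$ for all $e$ that converges to $x$ in $\mathbb{Z}_p$; let $\mathbf{BSR}(I)\subseteq\mathbb{Z}_p$ be the set of all Bernstein–Sato roots of $I$. The ring $R$ is $F$-finite if its Frobenius endomorphism $r\mapsto r^p$ is finite. Theorem. Let $R$ and $S$ be regular $F$-finite commutative rings of characteristic $p$, let $I\subseteq R$ and $J\subseteq S$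 be ideals, and set $Q=R\otimes_{\mathbb{F}_p}S$. Let $\mathfrak{A}=I\otimes_{\mathbb{F}_p} S+R\otimes_{\mathbb{F}_p} J$ be the ideal of $Q$ generated by $f\otimes 1$ and $1\otimes g$ for $f\in I$, $g\in J$, and let $\mathfrak{B}=I\otimes_{\mathbb{F}_p} J$ be the ideal of $Q$ generated by the elements $f\otimes g$ for $f\in I$, $g\in J$. (1) $\mathbf{BSR}(\mathfrak{A})=\{x+y : x\in\mathbf{BSR}(I),\ y\in\mathbf{BSR}(J)\}$. (2) If $I$ is not contained in the nilradical of $R$ and $J$ is not contained in the nilradical of $S$, then $\mathbf{BSR}(\mathfrak{B})=\mathbf{BSR}(I)\cup\mathbf{BSR}(J)$. -/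

import Mathlib

open Filter Topology
open scoped TensorProduct

namespace BernsteinSato

section Definitions

variable (p : ℕ) [Fact p.Prime] (R : Type*) [CommRing R] [CharP R p]

/-- The ring `R` of characteristic `p` is `F`-finite: its Frobenius endomorphism `r ↦ r ^ p` is
a finite ring homomorphism, i.e. `R` is a finite module over its subring of `p`-th powers. -/
def IsFFinite : Prop := (frobenius R p).Finite

/-- The subring `R^{p^e} = {r ^ (p ^ e) : r ∈ R}` of `p^e`-th powers of `R`. -/
abbrev powSubring (e : ℕ) : Subring R := (iterateFrobenius R p e).range

/-- The ring `D_R^{(e)} = End_{R^{p^e}}(R)` of differential operators of level `e` on `R`. -/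
abbrev DiffOp (e : ℕ) : Type _ := Module.End (powSubring p R e) R

variable {R}

/-- `D_R^{(e)} · I`: the `D_R^{(e)}`-submodule of `R` generated by the ideal `I`, where
`D_R^{(e)}` acts on `R` by evaluation of operators. -/
def diffOpSpan (e : ℕ) (I : Ideal R) : Submodule (DiffOp p R e) R :=
  Submodule.span (DiffOp p R e) (I : Set R)

/-- The set of `n` such that `D_R^{(e)} · I ^ n` strictly contains `D_R^{(e)} · I ^ (n + 1)`. -/
def diffJumps (I : Ideal R) (e : ℕ) : Set ℕ :=
  {n | diffOpSpan p e (I ^ (n + 1)) < diffOpSpan p e (I ^ n)}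

/-- The set of Bernstein-Sato roots of the ideal `I`: the `p`-adic limits of sequences `ν` such
that `ν e` belongs to `diffJumps p I e` for every `e`. -/
def BSR (I : Ideal R) : Set ℤ_[p] :=
  {x | ∃ ν : ℕ → ℕ, (∀ e, ν e ∈ diffJumps p I e) ∧
    Tendsto (fun e => (ν e : ℤ_[p])) atTop (𝓝 x)}

end Definitions

section TensorProduct

variable {p : ℕ} [Fact p.Prime] {R S : Type*} [CommRing R] [CommRing S]
  [Algebra (ZMod p) R] [Algebra (ZMod p) S]

/-- The tensor product over `𝔽_p` of two (nonzero) rings of characteristic `p` is again a ring of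
characteristic `p`. -/
instance charP_tensorProduct [CharP R p] [CharP S p] : CharP (R ⊗[ZMod p] S) p := by
  have : Nontrivial R := CharP.nontrivial_of_char_ne_one (Fact.out : p.Prime).ne_one
  have : Nontrivial S := CharP.nontrivial_of_char_ne_one (Fact.out : p.Prime).ne_one
  have : Nontrivial (R ⊗[ZMod p] S) :=
    Algebra.TensorProduct.nontrivial_of_algebraMap_injective_of_flat_left (ZMod p) R S
      (algebraMap (ZMod p) S).injective
  exact charP_of_injective_algebraMap (algebraMap (ZMod p) (R ⊗[ZMod p] S)).injective p

/-- The ideal of `R ⊗ S` generated by (the images of) `I` and `J`, that is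
`I ⊗ S + R ⊗ J`. -/
def sumIdeal (I : Ideal R) (J : Ideal S) : Ideal (R ⊗[ZMod p] S) :=
  I.map (Algebra.TensorProduct.includeLeft : R →ₐ[ZMod p] R ⊗[ZMod p] S) ⊔
    J.map (Algebra.TensorProduct.includeRight : S →ₐ[ZMod p] R ⊗[ZMod p] S)

/-- The ideal `I ⊗ J` of `R ⊗ S`, generated by the elements `f ⊗ g` with `f ∈ I`, `g ∈ J`. -/
def tensorIdeal (I : Ideal R) (J : Ideal S) : Ideal (R ⊗[ZMod p] S) :=
  Ideal.span {q | ∃ f ∈ I, ∃ g ∈ J, q = f ⊗ₜ[ZMod p] g}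

end TensorProduct

end BernsteinSato

/-! Everything rests on the identity D·(I ⊗ J) = (D·I) ⊗ (D·J) of `ZMod p`-subspaces of R ⊗ S, at
each level e (`diffSpan_tensorIdeal`). For ⊆, the right side must be stable under every operator of
R ⊗ S; contracting such an operator against a linear form on one factor yields an operator of level
e on the other, so stability can be tested slice by slice. Since 𝔄^n = ∑ I^i ⊗ J^j over i + j = n
and 𝔅^n = I^n ⊗ J^n, linear algebra then shows that the jumps of 𝔄 are the sums of a jump of I and a
jump of J, and that those of 𝔅 are the union. Compactness of ℤ_p, together with jump sets that
shrink as e grows, carries both statements to the limit. -/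

namespace BernsteinSato

/-! ### Tensor products of subspaces over a field -/

section TensorSubspace

variable {k V W : Type*} [Field k] [AddCommGroup V] [AddCommGroup W] [Module k V] [Module k W]

/-- The image of `F ⊗ G` in `V ⊗ W`, for subspaces `F` of `V` and `G` of `W`. -/
def tensorSubspace (F : Submodule k V) (G : Submodule k W) : Submodule k (V ⊗[k] W) :=
  Submodule.map₂ (TensorProduct.mk k V W) F G

theorem tmul_mem_tensorSubspace {F : Submodule k V} {G : Submodule k W} {f : V} {g : W}
    (hf : f ∈ F) (hg : g ∈ G) : f ⊗ₜ[k] g ∈ tensorSubspace F G :=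
  Submodule.apply_mem_map₂ _ hf hg

theorem tensorSubspace_le {F : Submodule k V} {G : Submodule k W} {T : Submodule k (V ⊗[k] W)} :
    tensorSubspace F G ≤ T ↔ ∀ f ∈ F, ∀ g ∈ G, f ⊗ₜ[k] g ∈ T :=
  Submodule.map₂_le

theorem tensorSubspace_mono {F F' : Submodule k V} {G G' : Submodule k W} (hF : F ≤ F')
    (hG : G ≤ G') : tensorSubspace F G ≤ tensorSubspace F' G' :=
  Submodule.map₂_le_map₂ hF hG

/-- Contraction of the second factor of `V ⊗ W` against a linear form. -/
def sliceRight (μ : W →ₗ[k] k) : V ⊗[k] W →ₗ[k] V :=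
  (TensorProduct.rid k V).toLinearMap ∘ₗ μ.lTensor V

/-- Contraction of the first factor of `V ⊗ W` against a linear form. -/
def sliceLeft (l : V →ₗ[k] k) : V ⊗[k] W →ₗ[k] W :=
  (TensorProduct.lid k W).toLinearMap ∘ₗ l.rTensor W

@[simp]
theorem sliceRight_tmul (μ : W →ₗ[k] k) (v : V) (w : W) : sliceRight μ (v ⊗ₜ[k] w) = μ w • v := by
  simp [sliceRight]

@[simp]
theorem sliceLeft_tmul (l : V →ₗ[k] k) (v : V) (w : W) : sliceLeft l (v ⊗ₜ[k] w) = l v • w := by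
  simp [sliceLeft]

theorem eq_zero_of_sliceRight_eq_zero {t : V ⊗[k] W}
    (h : ∀ μ : W →ₗ[k] k, sliceRight μ t = 0) : t = 0 := by
  classical
  let b := Module.Basis.ofVectorSpace k W
  apply (TensorProduct.equivFinsuppOfBasisRight (M := V) b).injective
  ext i
  have key : ∀ u : V ⊗[k] W,
      TensorProduct.equivFinsuppOfBasisRight (M := V) b u i = sliceRight (b.coord i) u := by
    intro u
    induction u with
    | zero => simp
    | tmul x y => simp
    | add x y hx hy => rw [map_add, map_add, Finsupp.add_apply, hx, hy]
  rw [key, h]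
  simp

theorem sliceLeft_eq_sliceRight_comm (l : V →ₗ[k] k) (t : V ⊗[k] W) :
    sliceLeft l t = sliceRight l (TensorProduct.comm k V W t) := by
  induction t with
  | zero => simp
  | tmul x y => simp
  | add x y hx hy => rw [map_add, map_add, map_add, hx, hy]

theorem eq_zero_of_sliceLeft_eq_zero {t : V ⊗[k] W}
    (h : ∀ l : V →ₗ[k] k, sliceLeft l t = 0) : t = 0 := by
  apply (TensorProduct.comm k V W).injective
  rw [map_zero]
  exact eq_zero_of_sliceRight_eq_zero fun l => by rw [← sliceLeft_eq_sliceRight_comm, h]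

/-- Projections onto F and G, applied in their respective factors, fix t because they fix all its
slices; their composite takes values in F ⊗ G. -/
theorem mem_tensorSubspace_of_slices {F : Submodule k V} {G : Submodule k W} {t : V ⊗[k] W}
    (hF : ∀ μ : W →ₗ[k] k, sliceRight μ t ∈ F) (hG : ∀ l : V →ₗ[k] k, sliceLeft l t ∈ G) :
    t ∈ tensorSubspace F G := by
  obtain ⟨P, hP⟩ := F.subtype.exists_leftInverse_of_injective (by simp)
  obtain ⟨P', hP'⟩ := G.subtype.exists_leftInverse_of_injective (by simp)
  have hPF : ∀ v ∈ F, (P v : V) = v := fun v hv =>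
    congrArg Subtype.val (LinearMap.congr_fun hP ⟨v, hv⟩)
  have hPG : ∀ v ∈ G, (P' v : W) = v := fun v hv =>
    congrArg Subtype.val (LinearMap.congr_fun hP' ⟨v, hv⟩)
  have h1 : (F.subtype ∘ₗ P).rTensor W t = t := by
    rw [← sub_eq_zero]
    refine eq_zero_of_sliceRight_eq_zero fun μ => ?_
    have : sliceRight μ ((F.subtype ∘ₗ P).rTensor W t) = F.subtype (P (sliceRight μ t)) := by
      generalize t = u
      induction u with
      | zero => simp
      | tmul x y => simp
      | add x y hx hy => simp only [map_add, hx, hy]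
    rw [map_sub, this, sub_eq_zero]
    exact hPF _ (hF μ)
  have h2 : (G.subtype ∘ₗ P').lTensor V t = t := by
    rw [← sub_eq_zero]
    refine eq_zero_of_sliceLeft_eq_zero fun l => ?_
    have : sliceLeft l ((G.subtype ∘ₗ P').lTensor V t) = G.subtype (P' (sliceLeft l t)) := by
      generalize t = u
      induction u with
      | zero => simp
      | tmul x y => simp
      | add x y hx hy => simp only [map_add, hx, hy]
    rw [map_sub, this, sub_eq_zero]
    exact hPG _ (hG l)
  rw [← h1, ← h2]
  generalize t = u
  induction u with
  | zero => simp
  | tmul x y => exact tmul_mem_tensorSubspace (P x).2 (P' y).2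
  | add x y hx hy => simpa only [map_add] using add_mem hx hy

theorem exists_form_separating {F F' : Submodule k V} (h : F' < F) :
    ∃ f ∈ F, ∃ l : V →ₗ[k] k, l f ≠ 0 ∧ ∀ x ∈ F', l x = 0 := by
  obtain ⟨f, hf, hf'⟩ := SetLike.exists_of_lt h
  obtain ⟨l, hl, hl'⟩ := Submodule.exists_le_ker_of_notMem hf'
  exact ⟨f, hf, l, hl, fun x hx => hl' hx⟩

theorem tmul_notMem_of_forms {f : V} {g : W} {l : V →ₗ[k] k} {μ : W →ₗ[k] k} (hl : l f ≠ 0)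
    (hμ : μ g ≠ 0) {T : Submodule k (V ⊗[k] W)}
    (hT : T ≤ LinearMap.ker (LinearMap.mul' k k ∘ₗ TensorProduct.map l μ)) :
    f ⊗ₜ[k] g ∉ T := fun h => by
  simpa [hl, hμ] using hT h

end TensorSubspace

/-! ### Subspaces stable under differential operators, and jumps -/

section DiffSpan

theorem powSubring_antitone (p : ℕ) [Fact p.Prime] (R : Type*) [CommRing R] [CharP R p]
    {e e' : ℕ} (h : e ≤ e') :
    powSubring p R e' ≤ powSubring p R e := by
  rintro _ ⟨r, rfl⟩
  refine ⟨r ^ p ^ (e' - e), ?_⟩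
  rw [iterateFrobenius_def, iterateFrobenius_def, ← pow_mul, ← pow_add, Nat.sub_add_cancel h]

variable (p : ℕ) [Fact p.Prime] {R : Type*} [CommRing R] [CharP R p] [Algebra (ZMod p) R]

/-- `D_R^{(e)} · I` as a vector space over the prime field. -/
def diffSpan (e : ℕ) (I : Ideal R) : Submodule (ZMod p) R :=
  AddSubgroup.toZModSubmodule p (diffOpSpan p e I).toAddSubgroup

variable {p}

/-- A subspace is stable under all differential operators of level `e`. -/
def IsDiffStable (e : ℕ) (T : Submodule (ZMod p) R) : Prop :=
  ∀ φ : DiffOp p R e, ∀ x ∈ T, φ x ∈ T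

theorem isDiffStable_diffSpan (e : ℕ) (I : Ideal R) : IsDiffStable e (diffSpan p e I) :=
  fun φ _ hx => (diffOpSpan p e I).smul_mem φ hx

theorem subset_diffSpan (e : ℕ) {I : Ideal R} {x : R} (hx : x ∈ I) : x ∈ diffSpan p e I :=
  Submodule.subset_span hx

theorem diffSpan_le {e : ℕ} {I : Ideal R} {T : Submodule (ZMod p) R} (hT : IsDiffStable e T)
    (h : ∀ x ∈ I, x ∈ T) : diffSpan p e I ≤ T := fun x hx => by
  refine Submodule.span_induction (p := fun y _ => y ∈ T) h T.zero_mem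
    (fun _ _ _ _ => T.add_mem) (fun φ y _ hy => hT φ y hy) hx

theorem diffSpan_mono (e : ℕ) {I J : Ideal R} (h : I ≤ J) : diffSpan p e I ≤ diffSpan p e J :=
  diffSpan_le (isDiffStable_diffSpan e J) fun _ hx => subset_diffSpan e (h hx)

theorem diffSpan_pow_antitone (e : ℕ) (I : Ideal R) {m n : ℕ} (h : m ≤ n) :
    diffSpan p e (I ^ n) ≤ diffSpan p e (I ^ m) :=
  diffSpan_mono e (Ideal.pow_le_pow_right h)

theorem mem_diffJumps {e n : ℕ} {I : Ideal R} :
    n ∈ diffJumps p I e ↔ diffSpan p e (I ^ (n + 1)) < diffSpan p e (I ^ n) := Iff.rfl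

theorem notMem_diffJumps {e n : ℕ} {I : Ideal R} :
    n ∉ diffJumps p I e ↔ diffSpan p e (I ^ (n + 1)) = diffSpan p e (I ^ n) := by
  rw [mem_diffJumps, lt_iff_le_and_ne, not_and_not_right]
  exact ⟨fun h => h (diffSpan_pow_antitone e I n.le_succ), fun h _ => h⟩

theorem IsDiffStable.mul_mem {e : ℕ} {T : Submodule (ZMod p) R} (hT : IsDiffStable e T) (r : R)
    {x : R} (hx : x ∈ T) : r * x ∈ T :=
  hT (LinearMap.mulLeft (powSubring p R e) r) x hx

theorem IsDiffStable.iSup {ι : Sort*} {e : ℕ} {T : ι → Submodule (ZMod p) R}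
    (hT : ∀ i, IsDiffStable e (T i)) : IsDiffStable e (⨆ i, T i) := by
  intro φ x hx
  suffices h : ⨆ i, T i ≤ (⨆ i, T i).comap (φ.toAddMonoidHom.toZModLinearMap p) from h hx
  exact iSup_le fun i y hy => Submodule.mem_iSup_of_mem i (hT i φ y hy)

theorem diffSpan_iSup {ι : Sort*} (e : ℕ) (H : ι → Ideal R) :
    diffSpan p e (⨆ i, H i) = ⨆ i, diffSpan p e (H i) := by
  refine le_antisymm (diffSpan_le (.iSup fun i => isDiffStable_diffSpan e _) fun x hx => ?_)
    (iSup_le fun i => diffSpan_mono e (le_iSup H i))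
  refine Submodule.iSup_induction H (motive := fun y => y ∈ ⨆ i, diffSpan p e (H i)) hx
    (fun i y hy => Submodule.mem_iSup_of_mem i (subset_diffSpan e hy)) (zero_mem _)
    fun _ _ => add_mem

theorem IsDiffStable.of_le {e e' : ℕ} (h : e ≤ e') {T : Submodule (ZMod p) R}
    (hT : IsDiffStable e' T) : IsDiffStable e T := fun φ =>
  hT { φ with map_smul' := fun c x => φ.map_smul ⟨c, powSubring_antitone p R h c.2⟩ x }

/-- Raising the level enlarges the ring of operators, so an equality of spans at level e persists at
level e'. -/
theorem diffJumps_antitone (I : Ideal R) {e e' : ℕ} (h : e ≤ e') :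
    diffJumps p I e' ⊆ diffJumps p I e := by
  intro n hn
  by_contra hc
  rw [notMem_diffJumps] at hc
  refine (mem_diffJumps.1 hn).not_ge ?_
  have hs := isDiffStable_diffSpan (p := p) e' (I ^ (n + 1))
  refine diffSpan_le hs fun x hx => ?_
  have : x ∈ diffSpan p e (I ^ (n + 1)) := hc ▸ subset_diffSpan e hx
  exact diffSpan_le (hs.of_le h) (fun y hy => subset_diffSpan e' hy) this

/-- Lets a convergent subsequence of jumps be reindexed as a full sequence. -/
theorem mem_BSR_of_subseq {I : Ideal R} {ν : ℕ → ℕ} {φ : ℕ → ℕ} (hφ : ∀ e, e ≤ φ e)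
    (hν : ∀ e, ν e ∈ diffJumps p I (φ e)) {x : ℤ_[p]}
    (hx : Tendsto (fun e => (ν e : ℤ_[p])) atTop (𝓝 x)) : x ∈ BSR p I :=
  ⟨ν, fun e => diffJumps_antitone I (hφ e) (hν e), hx⟩

end DiffSpan

/-! ### Differential operators, jumps and roots on the tensor product -/

section Tensor

variable {p : ℕ} [Fact p.Prime] {R S : Type*} [CommRing R] [CommRing S]
  [Algebra (ZMod p) R] [Algebra (ZMod p) S]

theorem sliceLeft_one_tmul_mul (l : R →ₗ[ZMod p] ZMod p) (s : S) (t : R ⊗[ZMod p] S) :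
    sliceLeft l ((1 ⊗ₜ s) * t) = s * sliceLeft l t := by
  induction t with
  | zero => simp
  | tmul x y => simp
  | add x y hx hy => rw [mul_add, map_add, map_add, hx, hy, mul_add]

theorem sliceRight_tmul_one_mul (μ : S →ₗ[ZMod p] ZMod p) (r : R) (t : R ⊗[ZMod p] S) :
    sliceRight μ ((r ⊗ₜ 1) * t) = r * sliceRight μ t := by
  induction t with
  | zero => simp
  | tmul x y => simp
  | add x y hx hy => rw [mul_add, map_add, map_add, hx, hy, mul_add]

theorem tensorIdeal_eq_mul (I : Ideal R) (J : Ideal S) :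
    tensorIdeal (p := p) I J =
      I.map (Algebra.TensorProduct.includeLeft : R →ₐ[ZMod p] R ⊗[ZMod p] S) *
        J.map (Algebra.TensorProduct.includeRight : S →ₐ[ZMod p] R ⊗[ZMod p] S) := by
  rw [Ideal.map, Ideal.map, Ideal.span_mul_span', tensorIdeal]
  congr 1
  ext q
  simp only [Set.mem_ofPred_eq, Set.mem_mul, Set.mem_image, SetLike.mem_coe]
  constructor
  · rintro ⟨f, hf, g, hg, rfl⟩
    exact ⟨_, ⟨f, hf, rfl⟩, _, ⟨g, hg, rfl⟩, by simp⟩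
  · rintro ⟨_, ⟨f, hf, rfl⟩, _, ⟨g, hg, rfl⟩, rfl⟩
    exact ⟨f, hf, g, hg, by simp⟩

theorem tensorIdeal_pow (I : Ideal R) (J : Ideal S) (n : ℕ) :
    tensorIdeal (p := p) I J ^ n = tensorIdeal (p := p) (I ^ n) (J ^ n) := by
  rw [tensorIdeal_eq_mul, tensorIdeal_eq_mul, mul_pow, Ideal.map_pow, Ideal.map_pow]

theorem _root_.Ideal.sup_pow_eq_iSup {A : Type*} [CommRing A] (I J : Ideal A) (n : ℕ) :
    (I ⊔ J) ^ n = ⨆ ij : Finset.HasAntidiagonal.antidiagonal n, I ^ ij.1.1 * J ^ ij.1.2 := by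
  induction n with
  | zero =>
    refine le_antisymm (le_iSup_of_le ⟨(0, 0), by simp⟩ (by simp)) (by simp)
  | succ n ih =>
    apply le_antisymm
    · rw [pow_succ, ih, Ideal.iSup_mul]
      refine iSup_le ?_
      rintro ⟨⟨i, j⟩, h⟩
      rw [Finset.HasAntidiagonal.mem_antidiagonal] at h
      rw [Ideal.mul_sup]
      refine sup_le (le_iSup_of_le ⟨(i + 1, j), by simp; omega⟩ ?_)
        (le_iSup_of_le ⟨(i, j + 1), by simp; omega⟩ ?_)
      · exact le_of_eq (by simp only; ring)
      · exact le_of_eq (by simp only; ring)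
    · refine iSup_le ?_
      rintro ⟨⟨i, j⟩, h⟩
      rw [Finset.HasAntidiagonal.mem_antidiagonal] at h
      change I ^ i * J ^ j ≤ _
      rw [← h, pow_add]
      exact Ideal.mul_mono (Ideal.pow_right_mono le_sup_left i) (Ideal.pow_right_mono le_sup_right j)

variable [CharP R p] [CharP S p]

theorem tmul_pow_mem_powSubring {e : ℕ} {a : R} {b : S} (ha : a ∈ powSubring p R e)
    (hb : b ∈ powSubring p S e) : a ⊗ₜ[ZMod p] b ∈ powSubring p (R ⊗[ZMod p] S) e := by
  obtain ⟨r, rfl⟩ := ha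
  obtain ⟨s, rfl⟩ := hb
  exact ⟨r ⊗ₜ s, by simp [iterateFrobenius_def, Algebra.TensorProduct.tmul_pow]⟩

theorem DiffOp.map_mul {R : Type*} [CommRing R] [CharP R p] {e : ℕ} (φ : DiffOp p R e) {c : R}
    (hc : c ∈ powSubring p R e) (x : R) : φ (c * x) = c * φ x :=
  φ.map_smul (⟨c, hc⟩ : powSubring p R e) x

/-- The operator `s ↦ (l ⊗ id) (Φ (f ⊗ s))` on `S`. -/
def DiffOp.sliceLeft {e : ℕ} (Φ : DiffOp p (R ⊗[ZMod p] S) e) (l : R →ₗ[ZMod p] ZMod p) (f : R) :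
    DiffOp p S e where
  toFun s := BernsteinSato.sliceLeft l (Φ (f ⊗ₜ s))
  map_add' s s' := by rw [TensorProduct.tmul_add, map_add, map_add]
  map_smul' c s := by
    have h : f ⊗ₜ[ZMod p] (c • s) = (1 ⊗ₜ (c : S)) * (f ⊗ₜ s) := by
      rw [Algebra.TensorProduct.tmul_mul_tmul, one_mul]; rfl
    rw [h, Φ.map_mul (tmul_pow_mem_powSubring (one_mem _) c.2), sliceLeft_one_tmul_mul]
    rfl

/-- The operator `r ↦ (id ⊗ μ) (Φ (r ⊗ g))` on `R`. -/
def DiffOp.sliceRight {e : ℕ} (Φ : DiffOp p (R ⊗[ZMod p] S) e) (μ : S →ₗ[ZMod p] ZMod p) (g : S) :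
    DiffOp p R e where
  toFun r := BernsteinSato.sliceRight μ (Φ (r ⊗ₜ g))
  map_add' s s' := by rw [TensorProduct.add_tmul, map_add, map_add]
  map_smul' c s := by
    have h : (c • s) ⊗ₜ[ZMod p] g = ((c : R) ⊗ₜ 1) * (s ⊗ₜ g) := by
      rw [Algebra.TensorProduct.tmul_mul_tmul, one_mul]; rfl
    rw [h, Φ.map_mul (tmul_pow_mem_powSubring c.2 (one_mem _)), sliceRight_tmul_one_mul]
    rfl

/-- The slices of Φ (f ⊗ g) are values at f and at g of operators on R and S, so they lie in F and
G. -/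
theorem IsDiffStable.tensorSubspace {e : ℕ} {F : Submodule (ZMod p) R} {G : Submodule (ZMod p) S}
    (hF : IsDiffStable e F) (hG : IsDiffStable e G) : IsDiffStable e (tensorSubspace F G) := by
  intro Φ t ht
  suffices h : BernsteinSato.tensorSubspace F G ≤
      (BernsteinSato.tensorSubspace F G).comap (Φ.toAddMonoidHom.toZModLinearMap p) from h ht
  exact tensorSubspace_le.2 fun f hf g hg => mem_tensorSubspace_of_slices
    (fun μ => hF (Φ.sliceRight μ g) f hf) fun l => hG (Φ.sliceLeft l f) g hg

/-- Frobenius is additive, so the p^e-th powers in R ⊗ S are sums of pure tensors of p^e-th powers.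
-/
theorem map_mul_of_mem_powSubring {e : ℕ} (L : R ⊗[ZMod p] S →ₗ[ZMod p] R ⊗[ZMod p] S)
    (h : ∀ a ∈ powSubring p R e, ∀ b ∈ powSubring p S e, ∀ x y,
      L ((a * x) ⊗ₜ (b * y)) = (a ⊗ₜ b) * L (x ⊗ₜ y)) (c : R ⊗[ZMod p] S)
    (hc : c ∈ powSubring p (R ⊗[ZMod p] S) e) (t : R ⊗[ZMod p] S) : L (c * t) = c * L t := by
  obtain ⟨c, rfl⟩ := hc
  induction c with
  | zero => simp
  | add x y hx hy => rw [map_add, add_mul, map_add, hx, hy, add_mul]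
  | tmul a b =>
    induction t with
    | zero => simp
    | add x y hx hy => rw [mul_add, map_add, map_add, hx, hy, mul_add]
    | tmul x y =>
      have := h _ ⟨a, rfl⟩ _ ⟨b, rfl⟩ x y
      simpa [iterateFrobenius_def, Algebra.TensorProduct.tmul_pow] using this

/-- The tensor product of two differential operators of level `e`. -/
def DiffOp.tensor {e : ℕ} (φ : DiffOp p R e) (ψ : DiffOp p S e) :
    DiffOp p (R ⊗[ZMod p] S) e where
  __ := (TensorProduct.map (φ.toAddMonoidHom.toZModLinearMap p)
    (ψ.toAddMonoidHom.toZModLinearMap p)).toAddMonoidHom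
  map_smul' c t := map_mul_of_mem_powSubring (e := e)
    (TensorProduct.map (φ.toAddMonoidHom.toZModLinearMap p)
      (ψ.toAddMonoidHom.toZModLinearMap p)) (fun a ha b hb x y => by
      simp only [TensorProduct.map_tmul, Algebra.TensorProduct.tmul_mul_tmul]
      exact congrArg₂ _ (φ.map_mul ha x) (ψ.map_mul hb y)) c c.2 t

theorem diffSpan_tensorIdeal (e : ℕ) (I : Ideal R) (J : Ideal S) :
    diffSpan p e (tensorIdeal (p := p) I J) =
      tensorSubspace (diffSpan p e I) (diffSpan p e J) := by
  have hT := (isDiffStable_diffSpan e I).tensorSubspace (isDiffStable_diffSpan (p := p) e J)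
  apply le_antisymm
  · refine diffSpan_le hT fun t ht => ?_
    refine Submodule.span_induction
      (p := fun y _ => y ∈ tensorSubspace (diffSpan p e I) (diffSpan p e J)) ?_ (zero_mem _)
      (fun _ _ _ _ => add_mem) (fun r y _ hy => hT.mul_mem r hy) ht
    rintro _ ⟨f, hf, g, hg, rfl⟩
    exact tmul_mem_tensorSubspace (subset_diffSpan e hf) (subset_diffSpan e hg)
  · have hs := isDiffStable_diffSpan e (tensorIdeal (p := p) I J)
    -- One factor is enlarged at a time, using the operators 1 ⊗ ψ and then φ ⊗ 1.
    have h1 : ∀ f ∈ I, ∀ g ∈ diffSpan p e J,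
        f ⊗ₜ[ZMod p] g ∈ diffSpan p e (tensorIdeal (p := p) I J) := fun f hf =>
      diffSpan_le (T := (diffSpan p e (tensorIdeal (p := p) I J)).comap
        (TensorProduct.mk (ZMod p) R S f))
        (fun ψ g hg => hs (DiffOp.tensor 1 ψ) _ hg)
        fun g hg => subset_diffSpan e (Ideal.subset_span ⟨f, hf, g, hg, rfl⟩)
    refine tensorSubspace_le.2 fun f hf g hg => ?_
    exact diffSpan_le (T := (diffSpan p e (tensorIdeal (p := p) I J)).comap
        ((TensorProduct.mk (ZMod p) R S).flip g))
        (fun φ x hx => hs (DiffOp.tensor φ 1) _ hx) (fun x hx => h1 x hx g hg) hf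

theorem diffSpan_sumIdeal_pow (e : ℕ) (I : Ideal R) (J : Ideal S) (n : ℕ) :
    diffSpan p e (sumIdeal (p := p) I J ^ n) = ⨆ ij : Finset.HasAntidiagonal.antidiagonal n,
      tensorSubspace (diffSpan p e (I ^ ij.1.1)) (diffSpan p e (J ^ ij.1.2)) := by
  rw [sumIdeal, Ideal.sup_pow_eq_iSup, diffSpan_iSup]
  refine iSup_congr fun ij => ?_
  rw [← Ideal.map_pow, ← Ideal.map_pow, ← tensorIdeal_eq_mul, diffSpan_tensorIdeal]

theorem mem_diffJumps_sumIdeal {e n : ℕ} {I : Ideal R} {J : Ideal S} :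
    n ∈ diffJumps p (sumIdeal (p := p) I J) e ↔
      ∃ i ∈ diffJumps p I e, ∃ j ∈ diffJumps p J e, i + j = n := by
  constructor
  · intro h
    by_contra! hc
    refine (mem_diffJumps.1 h).not_ge ?_
    rw [diffSpan_sumIdeal_pow, diffSpan_sumIdeal_pow]
    refine iSup_le ?_
    rintro ⟨⟨i, j⟩, hij⟩
    rw [Finset.HasAntidiagonal.mem_antidiagonal] at hij
    simp only at hij
    -- Whichever exponent is not a jump can be raised by one without changing the span, which moves
    -- the term into degree n + 1.
    by_cases hi : i ∈ diffJumps p I e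
    · have hj : j ∉ diffJumps p J e := fun hj => hc i hi j hj hij
      rw [notMem_diffJumps] at hj
      exact le_iSup_of_le ⟨(i, j + 1), by simp; omega⟩ (tensorSubspace_mono le_rfl hj.ge)
    · rw [notMem_diffJumps] at hi
      exact le_iSup_of_le ⟨(i + 1, j), by simp; omega⟩ (tensorSubspace_mono hi.ge le_rfl)
  · rintro ⟨i, hi, j, hj, rfl⟩
    obtain ⟨f, hf, l, hlf, hl⟩ := exists_form_separating (mem_diffJumps.1 hi)
    obtain ⟨g, hg, μ, hμg, hμ⟩ := exists_form_separating (mem_diffJumps.1 hj)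
    by_contra hc
    rw [notMem_diffJumps] at hc
    refine tmul_notMem_of_forms hlf hμg (T := diffSpan p e (sumIdeal (p := p) I J ^ (i + j + 1)))
      ?_ ?_
    · rw [diffSpan_sumIdeal_pow]
      refine iSup_le ?_
      rintro ⟨⟨a, b⟩, hab⟩
      rw [Finset.HasAntidiagonal.mem_antidiagonal] at hab
      simp only at hab
      refine tensorSubspace_le.2 fun x hx y hy => ?_
      -- As a + b = i + j + 1, one exponent exceeds its jump, so l ⊗ μ kills the term.
      rcases (by omega : i + 1 ≤ a ∨ j + 1 ≤ b) with h | h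
      · simp [hl x (diffSpan_pow_antitone e I h hx)]
      · simp [hμ y (diffSpan_pow_antitone e J h hy)]
    · rw [hc, diffSpan_sumIdeal_pow]
      exact Submodule.mem_iSup_of_mem ⟨(i, j), by simp⟩ (tmul_mem_tensorSubspace hf hg)

/-- Keeps the other tensor factor nonzero, so that a jump of one ideal survives in I ⊗ J. -/
theorem bot_lt_diffSpan_pow {I : Ideal R}
    (hI : ¬ I ≤ nilradical R) (e n : ℕ) : ⊥ < diffSpan p e (I ^ n) := by
  obtain ⟨f, hf, hnil⟩ := SetLike.not_le_iff_exists.1 hI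
  rw [bot_lt_iff_ne_bot, Submodule.ne_bot_iff]
  exact ⟨f ^ n, subset_diffSpan e (Ideal.pow_mem_pow hf n), fun h => hnil ⟨n, h⟩⟩

theorem diffJumps_tensorIdeal {e : ℕ} {I : Ideal R} {J : Ideal S}
    (hI : ¬ I ≤ nilradical R) (hJ : ¬ J ≤ nilradical S) :
    diffJumps p (tensorIdeal (p := p) I J) e = diffJumps p I e ∪ diffJumps p J e := by
  ext n
  constructor
  · contrapose
    rw [Set.mem_union, not_or, notMem_diffJumps, notMem_diffJumps, notMem_diffJumps]
    rintro ⟨hi, hj⟩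
    rw [tensorIdeal_pow, tensorIdeal_pow, diffSpan_tensorIdeal, diffSpan_tensorIdeal, hi, hj]
  · intro h
    by_contra hc
    rw [notMem_diffJumps, tensorIdeal_pow, tensorIdeal_pow, diffSpan_tensorIdeal,
      diffSpan_tensorIdeal] at hc
    rcases h with h | h
    · obtain ⟨f, hf, l, hlf, hl⟩ := exists_form_separating (mem_diffJumps.1 h)
      obtain ⟨g, hg, μ, hμg, -⟩ := exists_form_separating (bot_lt_diffSpan_pow (p := p) hJ e n)
      refine tmul_notMem_of_forms hlf hμg (tensorSubspace_le.2 fun x hx y _ => ?_)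
        (hc ▸ tmul_mem_tensorSubspace hf hg)
      simp [hl x hx]
    · obtain ⟨f, hf, l, hlf, -⟩ := exists_form_separating (bot_lt_diffSpan_pow (p := p) hI e n)
      obtain ⟨g, hg, μ, hμg, hμ⟩ := exists_form_separating (mem_diffJumps.1 h)
      refine tmul_notMem_of_forms hlf hμg (tensorSubspace_le.2 fun x _ y hy => ?_)
        (hc ▸ tmul_mem_tensorSubspace hf hg)
      simp [hμ y hy]

theorem BSR_sumIdeal (I : Ideal R) (J : Ideal S) :
    BSR p (sumIdeal (p := p) I J) = {z : ℤ_[p] | ∃ x ∈ BSR p I, ∃ y ∈ BSR p J, z = x + y} := by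
  ext z
  constructor
  · rintro ⟨ν, hν, hz⟩
    choose a ha b hb hab using fun e => mem_diffJumps_sumIdeal.1 (hν e)
    -- Only a + b is known to converge; once a converges along a subsequence, so does b, as a
    -- difference.
    obtain ⟨x, φ, hφ, hx⟩ := CompactSpace.tendsto_subseq fun e => (a e : ℤ_[p])
    refine ⟨x, mem_BSR_of_subseq hφ.id_le (fun e => ha (φ e)) hx, z - x,
      mem_BSR_of_subseq (ν := fun e => b (φ e)) hφ.id_le (fun e => hb (φ e)) ?_, by ring⟩
    convert (hz.comp hφ.tendsto_atTop).sub hx using 2 with e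
    simp [← hab]
  · rintro ⟨x, ⟨a, ha, hx⟩, y, ⟨b, hb, hy⟩, rfl⟩
    exact ⟨fun e => a e + b e,
      fun e => mem_diffJumps_sumIdeal.2 ⟨a e, ha e, b e, hb e, rfl⟩, by simpa using hx.add hy⟩

theorem BSR_tensorIdeal {I : Ideal R} {J : Ideal S} (hI : ¬ I ≤ nilradical R)
    (hJ : ¬ J ≤ nilradical S) : BSR p (tensorIdeal (p := p) I J) = BSR p I ∪ BSR p J := by
  ext z
  constructor
  · rintro ⟨ν, hν, hz⟩
    simp only [diffJumps_tensorIdeal hI hJ, Set.mem_union] at hν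
    -- One of the two ideals must account for infinitely many terms of the sequence.
    by_cases h : ∃ᶠ e in atTop, ν e ∈ diffJumps p I e
    · obtain ⟨φ, hφ, h⟩ := extraction_of_frequently_atTop h
      exact Or.inl (mem_BSR_of_subseq (ν := fun e => ν (φ e)) hφ.id_le h
        (hz.comp hφ.tendsto_atTop))
    · have h' : ∀ᶠ e in atTop, ν e ∈ diffJumps p J e := by
        filter_upwards [not_frequently.1 h] with e he using (hν e).resolve_left he
      obtain ⟨φ, hφ, h⟩ := extraction_of_frequently_atTop h'.frequently
      exact Or.inr (mem_BSR_of_subseq (ν := fun e => ν (φ e)) hφ.id_le h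
        (hz.comp hφ.tendsto_atTop))
  · rintro (⟨ν, hν, hz⟩ | ⟨ν, hν, hz⟩)
    · exact ⟨ν, fun e => diffJumps_tensorIdeal hI hJ ▸ Or.inl (hν e), hz⟩
    · exact ⟨ν, fun e => diffJumps_tensorIdeal hI hJ ▸ Or.inr (hν e), hz⟩

end Tensor

end BernsteinSato

theorem theorem6p2 {p : ℕ} [Fact p.Prime] {R S : Type*} [CommRing R] [CommRing S]
    [CharP R p] [CharP S p] [Algebra (ZMod p) R] [Algebra (ZMod p) S]
    [IsRegularRing R] [IsRegularRing S]
    (hR : BernsteinSato.IsFFinite p R) (hS : BernsteinSato.IsFFinite p S)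
    (I : Ideal R) (J : Ideal S) :
    BernsteinSato.BSR p (BernsteinSato.sumIdeal (p := p) I J) =
        {z : ℤ_[p] | ∃ x ∈ BernsteinSato.BSR p I, ∃ y ∈ BernsteinSato.BSR p J, z = x + y} ∧
      (¬ I ≤ nilradical R → ¬ J ≤ nilradical S →
        BernsteinSato.BSR p (BernsteinSato.tensorIdeal (p := p) I J) =
          BernsteinSato.BSR p I ∪ BernsteinSato.BSR p J) := by
  exact ⟨BernsteinSato.BSR_sumIdeal I J, fun hI hJ => BernsteinSato.BSR_tensorIdeal hI hJ⟩
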